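/- Let $\mathbb{K}=\mathbb{R}$ or $\mathbb{C}$. A Poisson structure on a smooth, real analytic or complex manifold $M$ is a bivector field $\pi$ of the same regularity whose bracket $\{a,b\}=\pi(da,db)$ on local functions satisfies the Jacobi identity; it is symplectic if $\pi$ is invertible at every point. A symplectic resolution of a Poisson manifold $(M,\pi)$ is a triple $(\Sigma,\Pi,\varphi)$, where $\Sigma$ is a Hausdorff manifold with $\dim\Sigma=\dim M$, $\Pi$ is a symplectic Poisson structure on $\Sigma$, and $\varphi:\Sigma\to M$ is a surjective Poisson morphism, i.e. $\Pi_\sigma(\varphi^*\alpha,\varphi^*\beta)=\pi_{\varphi(\sigma)}(\alpha,\beta)$ for all $\sigma\in\Sigma$ and $\alpha,\beta\in T^*_{\varphi(\sigma)}M$. The resolution is called smooth, real analytic or holomorphic when $\Sigma$, $\Pi$ and $\varphi$ are; it is proper if the inverse image under $\varphi$ of every compact set is compact, and connected if $\Sigma$ is connected. (1) Let $g:\mathbb{R}^2\to\mathbb{R}$ be a smooth function with $g(x,y)\neq 0$ whenever $x\neq 0$, and equip $\mathbb{R}^2$ with the Poisson structure $\{x,y\}=f(x,y)=x\,g(x,y)$.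 Then $(\mathbb{R}^2,\{\cdot,\cdot\})$ admits no proper smooth symplectic resolution. (2) If moreover $f$ is real analytic, then $(\mathbb{R}^2,\{\cdot,\cdot\})$ admits no connected, second countable, real analytic symplectic resolution. (3) Let $U\subset\mathbb{C}^2$ be an open set containing $(0,0)$, and let $f(x,y)=x\,g(x,y)$ be a holomorphic function on $U$, where $g(x,y)\neq 0$ for every $(x,y)\in U$ with $x\neq 0$. Then $U$ with the holomorphic Poisson structure $\{x,y\}=f(x,y)$ admits no connected, second countable, holomorphic symplectic resolution. -/

import Mathlib

open scoped Manifold ContDiff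

universe u v w

namespace PoissonGeometry

section General

variable {𝕜 : Type u} [RCLike 𝕜]

/-- The cotangent space `T*_x M` of a manifold modelled on the normed space `E`. -/
abbrev Cotangent (𝕜 : Type u) [RCLike 𝕜] (E : Type v) [NormedAddCommGroup E] [NormedSpace 𝕜 E]
    {M : Type w} [TopologicalSpace M] [ChartedSpace E M] (x : M) : Type _ :=
  TangentSpace 𝓘(𝕜, E) x →L[𝕜] 𝕜

/-- A (not necessarily regular) bivector field on `M`: a skew-symmetric bilinear form on each
cotangent space. -/
structure BivectorField (𝕜 : Type u) [RCLike 𝕜] (E : Type v) [NormedAddCommGroup E]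
    [NormedSpace 𝕜 E] (M : Type w) [TopologicalSpace M] [ChartedSpace E M] where
  /-- The bilinear form at the point `x`. -/
  form : ∀ x : M, Cotangent 𝕜 E x →ₗ[𝕜] Cotangent 𝕜 E x →ₗ[𝕜] 𝕜
  isAlt : ∀ x : M, (form x).IsAlt

variable {E : Type v} [NormedAddCommGroup E] [NormedSpace 𝕜 E]
  {M : Type w} [TopologicalSpace M] [ChartedSpace E M]

/-- The bracket `{a, b}(x) = π_x(d_x a, d_x b)`. -/
noncomputable def BivectorField.bracket (π : BivectorField 𝕜 E M) (a b : M → 𝕜) (x : M) : 𝕜 :=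
  π.form x (mvfderiv 𝓘(𝕜, E) a x) (mvfderiv 𝓘(𝕜, E) b x)

/-- `π` is a Poisson structure of class `C^n` (meant for `n = ∞`: smooth, and `n = ω`: real
analytic or holomorphic, according to `𝕜`): the bracket of two `C^n` functions on an open set is
`C^n` on that set, and it satisfies the Jacobi identity. Local functions are used because there
may be few global analytic functions. -/
structure BivectorField.IsPoisson (n : WithTop ℕ∞) (π : BivectorField 𝕜 E M) : Prop where
  contMDiffOn_bracket : ∀ V : Set M, IsOpen V → ∀ a b : M → 𝕜,
    ContMDiffOn 𝓘(𝕜, E) 𝓘(𝕜, 𝕜) n a V → ContMDiffOn 𝓘(𝕜, E) 𝓘(𝕜, 𝕜) n b V →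
    ContMDiffOn 𝓘(𝕜, E) 𝓘(𝕜, 𝕜) n (π.bracket a b) V
  jacobi : ∀ V : Set M, IsOpen V → ∀ a b c : M → 𝕜,
    ContMDiffOn 𝓘(𝕜, E) 𝓘(𝕜, 𝕜) n a V → ContMDiffOn 𝓘(𝕜, E) 𝓘(𝕜, 𝕜) n b V →
    ContMDiffOn 𝓘(𝕜, E) 𝓘(𝕜, 𝕜) n c V → ∀ x ∈ V,
    π.bracket a (π.bracket b c) x + π.bracket b (π.bracket c a) x
      + π.bracket c (π.bracket a b) x = 0

/-- `π` is a symplectic Poisson structure of class `C^n`: a Poisson structure that is invertible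
at every point. -/
structure BivectorField.IsSymplectic (n : WithTop ℕ∞) (π : BivectorField 𝕜 E M) : Prop where
  isPoisson : π.IsPoisson n
  nondegenerate : ∀ x : M, (π.form x).Nondegenerate

/-- `(S, ϖ, φ)` is a symplectic resolution of class `C^n` of `(M, π)`: `(S, ϖ)` is symplectic of
the same dimension as `M`, and `φ : S → M` is a surjective Poisson morphism, that is, a `C^n` map
with `ϖ_s (φ^* α, φ^* β) = π_{φ s} (α, β)`. -/
structure IsSymplecticResolution (n : WithTop ℕ∞) (π : BivectorField 𝕜 E M)
    {F : Type*} [NormedAddCommGroup F] [NormedSpace 𝕜 F]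
    {S : Type*} [TopologicalSpace S] [ChartedSpace F S]
    (ϖ : BivectorField 𝕜 F S) (φ : S → M) : Prop where
  finrank_eq : Module.finrank 𝕜 F = Module.finrank 𝕜 E
  isSymplectic : ϖ.IsSymplectic n
  contMDiff : ContMDiff 𝓘(𝕜, F) 𝓘(𝕜, E) n φ
  form_comp : ∀ (s : S) (α β : Cotangent 𝕜 E (φ s)),
    ϖ.form s (α.comp (mfderiv 𝓘(𝕜, F) 𝓘(𝕜, E) φ s)) (β.comp (mfderiv 𝓘(𝕜, F) 𝓘(𝕜, E) φ s))
      = π.form (φ s) α β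
  surjective : Function.Surjective φ

end General

section Planar

variable {𝕜 : Type u} [RCLike 𝕜] {M : Type w} [TopologicalSpace M] [ChartedSpace (𝕜 × 𝕜) M]

/-- The coordinate vector `∂_x = (1, 0)` in `T_z M = 𝕜²`. -/
def coordX (𝕜 : Type u) [RCLike 𝕜] {M : Type w} [TopologicalSpace M] [ChartedSpace (𝕜 × 𝕜) M]
    (z : M) : TangentSpace 𝓘(𝕜, 𝕜 × 𝕜) z :=
  ((1, 0) : 𝕜 × 𝕜)

/-- The coordinate vector `∂_y = (0, 1)` in `T_z M = 𝕜²`. -/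
def coordY (𝕜 : Type u) [RCLike 𝕜] {M : Type w} [TopologicalSpace M] [ChartedSpace (𝕜 × 𝕜) M]
    (z : M) : TangentSpace 𝓘(𝕜, 𝕜 × 𝕜) z :=
  ((0, 1) : 𝕜 × 𝕜)

/-- The bivector field `f ∂_x ∧ ∂_y`. It is used for `M = 𝕜²` and for open subsets `M` of `𝕜²`,
whose charts are the identity and the inclusion; there it satisfies `{x, y} = f`, see
`planarBivector_bracket_coord` and `planarBivector_bracket_coord_opens`. -/
noncomputable def planarBivector (f : M → 𝕜) : BivectorField 𝕜 (𝕜 × 𝕜) M where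
  form z := LinearMap.mk₂ 𝕜
    (fun α β : Cotangent 𝕜 (𝕜 × 𝕜) z =>
      f z * (α (coordX 𝕜 z) * β (coordY 𝕜 z) - α (coordY 𝕜 z) * β (coordX 𝕜 z)))
    (fun α₁ α₂ β => by simp only [add_apply]; ring)
    (fun c α β => by simp only [smul_apply, smul_eq_mul]; ring)
    (fun α β₁ β₂ => by simp only [add_apply]; ring)
    (fun c α β => by simp only [smul_apply, smul_eq_mul]; ring)
  isAlt z α := by simp only [LinearMap.mk₂_apply]; ring

theorem planarBivector_bracket (f a b : M → 𝕜) (z : M) :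
    (planarBivector f).bracket a b z =
      f z * (mvfderiv 𝓘(𝕜, 𝕜 × 𝕜) a z (coordX 𝕜 z) * mvfderiv 𝓘(𝕜, 𝕜 × 𝕜) b z (coordY 𝕜 z)
        - mvfderiv 𝓘(𝕜, 𝕜 × 𝕜) a z (coordY 𝕜 z) * mvfderiv 𝓘(𝕜, 𝕜 × 𝕜) b z (coordX 𝕜 z)) :=
  rfl

theorem planarBivector_bracket_coord (f : 𝕜 × 𝕜 → 𝕜) (z : 𝕜 × 𝕜) :
    (planarBivector f).bracket Prod.fst Prod.snd z = f z := by
  have h1 : mvfderiv 𝓘(𝕜, 𝕜 × 𝕜) (Prod.fst : 𝕜 × 𝕜 → 𝕜) z = ContinuousLinearMap.fst 𝕜 𝕜 𝕜 := by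
    rw [mvfderiv, mfderiv_eq_fderiv, fderiv_fst]; rfl
  have h2 : mvfderiv 𝓘(𝕜, 𝕜 × 𝕜) (Prod.snd : 𝕜 × 𝕜 → 𝕜) z = ContinuousLinearMap.snd 𝕜 𝕜 𝕜 := by
    rw [mvfderiv, mfderiv_eq_fderiv, fderiv_snd]; rfl
  have e : (planarBivector f).bracket Prod.fst Prod.snd z
      = f z * ((1 : 𝕜) * 1 - 0 * 0) := by
    rw [planarBivector_bracket, h1, h2]; rfl
  rw [e]; ring

theorem planarBivector_bracket_coord_opens (U : TopologicalSpace.Opens (𝕜 × 𝕜)) (f : U → 𝕜)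
    (z : U) :
    (planarBivector f).bracket (fun p : U => (p : 𝕜 × 𝕜).1) (fun p : U => (p : 𝕜 × 𝕜).2) z
      = f z := by
  have hc : (chartAt (𝕜 × 𝕜) z : U → 𝕜 × 𝕜) = Subtype.val := rfl
  have hev : ∀ᶠ p in nhds (z : 𝕜 × 𝕜), ((chartAt (𝕜 × 𝕜) z).symm p : 𝕜 × 𝕜) = p := by
    have : (chartAt (𝕜 × 𝕜) z).target ∈ nhds (chartAt (𝕜 × 𝕜) z z) :=
      chart_target_mem_nhds (𝕜 × 𝕜) z
    filter_upwards [this] with p hp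
    exact (chartAt (𝕜 × 𝕜) z).right_inv hp
  have key : ∀ L : 𝕜 × 𝕜 →L[𝕜] 𝕜,
      mvfderiv 𝓘(𝕜, 𝕜 × 𝕜) (fun p : U => L (p : 𝕜 × 𝕜)) z = L := by
    intro L
    have hd : HasMFDerivAt 𝓘(𝕜, 𝕜 × 𝕜) 𝓘(𝕜, 𝕜) (fun p : U => L (p : 𝕜 × 𝕜)) z L := by
      refine ⟨(L.continuous.comp continuous_subtype_val).continuousAt, ?_⟩
      refine HasFDerivAt.hasFDerivWithinAt ?_
      refine L.hasFDerivAt.congr_of_eventuallyEq ?_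
      filter_upwards [hev] with p hp
      change L (((chartAt (𝕜 × 𝕜) z).symm p : U) : 𝕜 × 𝕜) = L p
      rw [hp]
    rw [mvfderiv, hd.mfderiv]; rfl
  have e : (planarBivector f).bracket (fun p : U => (p : 𝕜 × 𝕜).1) (fun p : U => (p : 𝕜 × 𝕜).2) z
      = f z * ((1 : 𝕜) * 1 - 0 * 0) := by
    rw [planarBivector_bracket]
    have h1 := key (ContinuousLinearMap.fst 𝕜 𝕜 𝕜)
    have h2 := key (ContinuousLinearMap.snd 𝕜 𝕜 𝕜)
    simp only [ContinuousLinearMap.coe_fst', ContinuousLinearMap.coe_snd'] at h1 h2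
    rw [h1, h2]; rfl
  rw [e]; ring

end Planar

end PoissonGeometry

/-!
Write `X = x ∘ φ` and `Y = y ∘ φ`. Since `φ` is Poisson and the symplectic form is nondegenerate,
the Jacobian `J` of `(X, Y)` in a planar chart of the resolution is `f ∘ φ` up to a bounded factor,
and `f = O(x)`, so `J = O(X)`.

*Proper maps.* Away from `X = 0`, the map `(log |X|, Y)` has Jacobian `J / X`, which is bounded.
Hence it sends the part of the compact set `φ⁻¹([0, 1]²)` where `X ≠ 0` to a set of finite area,
although by surjectivity of `φ` the image contains the half-strip `(-∞, 0] × [0, 1]`.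

*Connected analytic resolutions.* Near a point where `dY ≠ 0`, take `Y` as a coordinate: `J = O(X)`
becomes `∂X/∂κ = O(X)` along the level curves of `Y`, so that `X` vanishes on a whole level curve
as soon as it vanishes at one of its points. As `X` is not locally zero, its zeros near a zero `p`
lie on the level curve through `p`. So `Y` takes countably many values on the zeros of `X` with
`dY ≠ 0`. It also has only countably many critical values: at a critical point where `Y` is not
locally constant, some iterated partial derivative `D` of `Y` vanishes with `dD ≠ 0`, and one
restricts `Y` to the hypersurface `D = 0` and inducts on the dimension. But `Y` takes uncountably
many values on `X = 0` because `φ` is surjective.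
-/

namespace PoissonGeometry

open scoped Topology NNReal

section Countable

theorem countable_image_of_forall_mem_nhdsWithin {α β : Type*} [TopologicalSpace α]
    [SecondCountableTopology α] {f : α → β} {A : Set α}
    (h : ∀ a ∈ A, ∃ N ∈ 𝓝[A] a, (f '' N).Countable) : (f '' A).Countable := by
  choose! N hN hfN using h
  obtain ⟨t, htA, ht, hAt⟩ := TopologicalSpace.countable_cover_nhdsWithin hN
  refine (ht.biUnion fun a ha => hfN a (htA ha)).mono ?_
  rw [← Set.image_iUnion₂]
  exact Set.image_mono hAt

variable {𝕜 : Type*} [NontriviallyNormedField 𝕜]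

theorem not_countable_of_mem_nhds [CompleteSpace 𝕜] {s : Set 𝕜} {a : 𝕜} (hs : s ∈ 𝓝 a) :
    ¬s.Countable := fun h =>
  Set.eq_empty_iff_forall_notMem.1 (interior_eq_empty_iff_dense_compl.2 (h.dense_compl 𝕜)) a
    (mem_interior_iff_mem_nhds.2 hs)

theorem not_countable_image_snd_axis [CompleteSpace 𝕜] (U : TopologicalSpace.Opens (𝕜 × 𝕜))
    {y : 𝕜} (hy : (0, y) ∈ U) :
    ¬((fun z : U => (z : 𝕜 × 𝕜).2) '' {z : U | (z : 𝕜 × 𝕜).1 = 0}).Countable := by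
  refine not_countable_of_mem_nhds (a := y) ?_
  filter_upwards [(Continuous.prodMk_right (0 : 𝕜)).continuousAt (U.isOpen.mem_nhds hy)] with y hy
  exact ⟨⟨(0, y), hy⟩, rfl, rfl⟩

theorem exists_fst_ne_zero (U : TopologicalSpace.Opens (𝕜 × 𝕜)) {y : 𝕜} (hy : (0, y) ∈ U) :
    ∃ z : U, (z : 𝕜 × 𝕜).1 ≠ 0 := by
  have hU : ∀ᶠ x in 𝓝[≠] (0 : 𝕜), (x, y) ∈ U := eventually_nhdsWithin_of_eventually_nhds
    ((Continuous.prodMk_left y).continuousAt (U.isOpen.mem_nhds hy))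
  obtain ⟨x, hxU, hx⟩ := (hU.and self_mem_nhdsWithin).exists
  exact ⟨⟨(x, y), hxU⟩, hx⟩

end Countable

section VanishingOnAxis

theorem isBigO_fst_mul {𝕜 E : Type*} [NormedField 𝕜] [TopologicalSpace E] {g : 𝕜 × E → 𝕜}
    {p : 𝕜 × E} (hg : ContinuousAt g p) : (fun z => z.1 * g z) =O[𝓝 p] Prod.fst := by
  simpa only [mul_one] using (Asymptotics.isBigO_refl Prod.fst (𝓝 p)).mul (hg.isBigO_one 𝕜)

theorem isBigO_fst_of_eventually_differentiableAt {E G : Type*} [NormedAddCommGroup E]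
    [NormedSpace ℂ E] [NormedAddCommGroup G] [NormedSpace ℂ G] {f : ℂ × E → G} {p : ℂ × E}
    (hf : ∀ᶠ z in 𝓝 p, DifferentiableAt ℂ f z) (hf0 : ∀ᶠ z in 𝓝 p, z.1 = 0 → f z = 0)
    (hp : p.1 = 0) : f =O[𝓝 p] Prod.fst := by
  have hbounded : ∀ᶠ z in 𝓝 p, ‖f z‖ ≤ ‖f p‖ + 1 :=
    hf.self_of_nhds.continuousAt.norm.eventually_le_const (lt_add_one _)
  obtain ⟨r, hr, hball⟩ := Metric.eventually_nhds_iff_ball.1 (hf.and (hf0.and hbounded))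
  rw [← ball_prod_same, hp] at hball
  refine .of_bound ((‖f p‖ + 1) / r) (Filter.eventually_of_mem (Metric.ball_mem_nhds p hr) ?_)
  rw [← ball_prod_same, hp]
  rintro ⟨x, y⟩ ⟨hx, hy⟩
  have h0 : f (0, y) = 0 := (hball (0, y) ⟨Metric.mem_ball_self hr, hy⟩).2.1 rfl
  have hd : DifferentiableOn ℂ (fun x => f (x, y)) (Metric.ball 0 r) := fun x hx =>
    ((hball (x, y) ⟨hx, hy⟩).1.comp x
      (differentiableAt_id.prodMk (differentiableAt_const y))).differentiableWithinAt
  have hmaps : Set.MapsTo (fun x => f (x, y)) (Metric.ball 0 r)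
      (Metric.closedBall (f (0, y)) (‖f p‖ + 1)) := fun x hx => by
    simpa only [h0, mem_closedBall_zero_iff] using (hball (x, y) ⟨hx, hy⟩).2.2
  simpa only [h0, dist_zero_right] using Complex.dist_le_div_mul_dist_of_mapsTo_ball hd hmaps hx

end VanishingOnAxis

section Differential

variable {𝕜 : Type*} [NontriviallyNormedField 𝕜] {E G : Type*} [NormedAddCommGroup E]
  [NormedSpace 𝕜 E] [NormedAddCommGroup G] [NormedSpace 𝕜 G]

theorem range_eq_top_of_ne_zero {L : E →L[𝕜] 𝕜} (hL : L ≠ 0) : L.range = ⊤ :=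
  LinearMap.range_eq_top.2 <| LinearMap.surjective (f := (L : E →ₗ[𝕜] 𝕜)) fun h =>
    hL (ContinuousLinearMap.coe_injective h)

theorem eventually_eq_of_iteratedFDeriv_eq_zero [CharZero 𝕜] [CompleteSpace G] {f : E → G}
    {p : E} (hf : AnalyticAt 𝕜 f p)
    (h : ∀ n ≠ 0, iteratedFDeriv 𝕜 n f p = 0) : ∀ᶠ z in 𝓝 p, f z = f p := by
  obtain ⟨q, r, hq⟩ := hf
  filter_upwards [Metric.eball_mem_nhds p hq.r_pos] with z hz
  have hsum := hq.hasSum_iteratedFDeriv (y := z - p) (by simpa [edist_eq_enorm_sub] using hz)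
  rw [add_sub_cancel] at hsum
  refine hsum.unique ?_
  convert hasSum_single 0 fun n hn => ?_
  · simp
  · simp [h n hn]

end Differential

section AnalyticSard

variable {𝕜 : Type*} [RCLike 𝕜] {E G : Type*} [NormedAddCommGroup E] [NormedSpace 𝕜 E]
  [NormedAddCommGroup G] [NormedSpace 𝕜 G]

theorem eqOn_zero_of_norm_fderiv_le [NormedSpace ℝ E] {u : E → G} {s : Set E} {C : ℝ} {a : E}
    (hs : StarConvex ℝ a s) (hu : ∀ x ∈ s, DifferentiableAt 𝕜 u x)
    (hC : ∀ x ∈ s, ‖fderiv 𝕜 u x‖ ≤ C * ‖u x‖) (ha : u a = 0) : Set.EqOn u 0 s := by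
  intro b hb
  let : NormedSpace ℝ G := .restrictScalars ℝ 𝕜 G
  set γ : ℝ →ᵃ[ℝ] E := AffineMap.lineMap a b
  have hγ : ∀ t ∈ Set.Icc (0 : ℝ) 1, γ t ∈ s := fun t ht => by
    have := hs.add_smul_sub_mem hb ht.1 ht.2
    rwa [add_comm, ← AffineMap.lineMap_apply_module'] at this
  have hderiv : ∀ t ∈ Set.Icc (0 : ℝ) 1, HasDerivAt (u ∘ γ) (fderiv 𝕜 u (γ t) (b - a)) t :=
    fun t ht => ((hu _ (hγ t ht)).hasFDerivAt.restrictScalars ℝ).comp_hasDerivAt t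
      AffineMap.hasDerivAt_lineMap
  have hbound : ∀ t ∈ Set.Ico (0 : ℝ) 1,
      ‖fderiv 𝕜 u (γ t) (b - a)‖ ≤ C * ‖b - a‖ * ‖(u ∘ γ) t‖ := fun t ht => by
    have hbound := (fderiv 𝕜 u (γ t)).le_of_opNorm_le (hC _ (hγ t (Set.Ico_subset_Icc_self ht)))
    exact (hbound _).trans_eq (mul_right_comm _ _ _)
  have := eq_zero_of_abs_deriv_le_mul_abs_self_of_eq_zero_right
    (fun t ht => (hderiv t ht).continuousAt.continuousWithinAt)
    (fun t ht => (hderiv t (Set.Ico_subset_Icc_self ht)).hasDerivWithinAt)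
    (by simpa [γ] using ha) hbound 1 (Set.right_mem_Icc.2 zero_le_one)
  simpa [γ] using this

theorem exists_straightening [CompleteSpace E] [FiniteDimensional 𝕜 G] {f : E → G}
    {p : E} (hf : AnalyticAt 𝕜 f p) (hsurj : (fderiv 𝕜 f p).range = ⊤) :
    ∃ e : OpenPartialHomeomorph E (G × (fderiv 𝕜 f p).ker), p ∈ e.source ∧
      (∀ z, (e z).1 = f z) ∧ AnalyticOnNhd 𝕜 e.symm e.target := by
  have := FiniteDimensional.complete 𝕜 G
  let Φ := hf.hasStrictFDerivAt.implicitFunctionDataOfComplemented f _ hsurj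
    (fderiv 𝕜 f p).ker_closedComplemented_of_finiteDimensional_range
  set e := Φ.toOpenPartialHomeomorph
  have hp : p ∈ e.source := Φ.pt_mem_toOpenPartialHomeomorph_source
  have hsymm : AnalyticAt 𝕜 e.symm (e p) := by
    refine (ImplicitFunctionData.contDiffAt_implicitFunction (φ := Φ) hf.contDiffAt ?_
      WithTop.top_ne_zero).analyticAt
    exact (ContinuousLinearMap.contDiff _).contDiffAt.comp p (contDiffAt_id.sub contDiffAt_const)
  refine ⟨(e.symm.restrOpen _ (isOpen_analyticAt 𝕜 e.symm)).symm, ?_, fun z => rfl,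
    fun c hc => hc.2⟩
  exact ⟨hp, hsymm⟩

theorem eventually_eq_or_exists_iteratedFDeriv {ι : Type*} (b : Module.Basis ι 𝕜 E)
    {Y : E → 𝕜} {p : E} (hY : AnalyticAt 𝕜 Y p) (hp : fderiv 𝕜 Y p = 0) :
    (∀ᶠ z in 𝓝 p, Y z = Y p) ∨
      ∃ (n : ℕ) (m : Fin n → ι), iteratedFDeriv 𝕜 n Y p (b ∘ m) = 0 ∧
        fderiv 𝕜 (fun z => iteratedFDeriv 𝕜 n Y z (b ∘ m)) p ≠ 0 := by
  rw [or_iff_not_imp_right]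
  intro h
  push Not at h
  have hzero : ∀ n, iteratedFDeriv 𝕜 (n + 1) Y p = 0 := by
    intro n
    induction n with
    | zero =>
      ext v
      rw [iteratedFDeriv_one_apply, hp]
      rfl
    | succ n ih =>
      refine ContinuousMultilinearMap.toMultilinearMap_injective
        (Module.Basis.ext_multilinear (fun _ => b) fun m => ?_)
      have hD := h (n + 1) (Fin.tail m) (by rw [ih]; rfl)
      rw [fderiv_continuousMultilinear_apply_const
        (hY.contDiffAt.differentiableAt_iteratedFDeriv (n := ω) (WithTop.coe_lt_top _))] at hD
      exact congr($hD (b (m 0)))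
  refine eventually_eq_of_iteratedFDeriv_eq_zero hY fun n hn => ?_
  obtain ⟨k, rfl⟩ := Nat.exists_eq_succ_of_ne_zero hn
  exact hzero k

theorem exists_countable_image_criticalSet_zeros [CompleteSpace E] {D Y : E → 𝕜} {p : E}
    (hD : AnalyticAt 𝕜 D p) (hD' : fderiv 𝕜 D p ≠ 0) (hY : AnalyticAt 𝕜 Y p)
    (IH : ∀ (u : (fderiv 𝕜 D p).ker → 𝕜) (W : Set (fderiv 𝕜 D p).ker), AnalyticOnNhd 𝕜 u W →
      (u '' {κ ∈ W | fderiv 𝕜 u κ = 0}).Countable) :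
    ∃ N ∈ 𝓝 p, (Y '' {z ∈ N | D z = 0 ∧ fderiv 𝕜 Y z = 0}).Countable := by
  obtain ⟨e, hpe, he, hsymm⟩ := exists_straightening hD (range_eq_top_of_ne_zero hD')
  let σ : (fderiv 𝕜 D p).ker → E := fun κ => e.symm (0, κ)
  let W := {κ | ((0, κ) : 𝕜 × (fderiv 𝕜 D p).ker) ∈ e.target ∧ AnalyticAt 𝕜 Y (σ κ)}
  have hσ : ∀ κ ∈ W, AnalyticAt 𝕜 σ κ := fun κ hκ =>
    (hsymm _ hκ.1).comp (f := fun κ => ((0 : 𝕜), κ)) (analyticAt_const.prod analyticAt_id)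
  refine ⟨e.source ∩ {z | AnalyticAt 𝕜 Y z}, Filter.inter_mem (e.open_source.mem_nhds hpe)
    hY.eventually_analyticAt, (IH (Y ∘ σ) W fun κ hκ => hκ.2.comp (hσ κ hκ)).mono ?_⟩
  rintro _ ⟨z, ⟨⟨hze, hzY⟩, hDz, hYz⟩, rfl⟩
  have hez : e z = (0, (e z).2) := Prod.ext ((he z).trans hDz) rfl
  have hσz : σ (e z).2 = z := (congrArg e.symm hez.symm).trans (e.left_inv hze)
  have hW : (e z).2 ∈ W := ⟨hez ▸ e.map_source hze, hσz.symm ▸ hzY⟩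
  refine ⟨(e z).2, ⟨hW, ?_⟩, congrArg Y hσz⟩
  rw [fderiv_comp _ hW.2.differentiableAt (hσ _ hW).differentiableAt, hσz, hYz,
    ContinuousLinearMap.zero_comp]

theorem eventually_eq_zero_or_fst_eq {W : 𝕜 × E → 𝕜} {q : 𝕜 × E} {C : ℝ}
    (hW : AnalyticAt 𝕜 W q)
    (hC : ∀ᶠ c in 𝓝 q, ‖fderiv 𝕜 W c ∘L ContinuousLinearMap.inr 𝕜 𝕜 E‖ ≤ C * ‖W c‖) :
    (∀ᶠ c in 𝓝 q, W c = 0) ∨ ∀ᶠ c in 𝓝 q, W c = 0 → c.1 = q.1 := by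
  let : NormedSpace ℝ E := .restrictScalars ℝ 𝕜 E
  obtain ⟨r, hr, hball⟩ := Metric.eventually_nhds_iff_ball.1 (hW.eventually_analyticAt.and hC)
  rw [← ball_prod_same] at hball
  have hslice : ∀ c ∈ Metric.ball q.1 r ×ˢ Metric.ball q.2 r, W c = 0 →
      ∀ κ ∈ Metric.ball q.2 r, W (c.1, κ) = 0 := by
    intro c hc hWc
    have hderiv : ∀ κ ∈ Metric.ball q.2 r, HasFDerivAt (fun κ => W (c.1, κ))
        (fderiv 𝕜 W (c.1, κ) ∘L ContinuousLinearMap.inr 𝕜 𝕜 E) κ := fun κ hκ =>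
      (hball (c.1, κ) ⟨hc.1, hκ⟩).1.differentiableAt.hasFDerivAt.comp κ
        (hasFDerivAt_prodMk_right c.1 κ)
    refine eqOn_zero_of_norm_fderiv_le (C := C) ((convex_ball q.2 r).starConvex hc.2)
      (fun κ hκ => (hderiv κ hκ).differentiableAt) (fun κ hκ => ?_) hWc
    rw [(hderiv κ hκ).fderiv]
    exact (hball (c.1, κ) ⟨hc.1, hκ⟩).2
  have hnear : ∀ᶠ c in 𝓝 q, c ∈ Metric.ball q.1 r ×ˢ Metric.ball q.2 r := by
    rw [ball_prod_same]
    exact Metric.ball_mem_nhds q hr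
  have hcenter : AnalyticAt 𝕜 (fun c₁ => W (c₁, q.2)) q.1 :=
    hW.comp (f := fun c₁ => (c₁, q.2)) (analyticAt_id.prod analyticAt_const)
  have hq : q.2 ∈ Metric.ball q.2 r := Metric.mem_ball_self hr
  rcases hcenter.eventually_eq_zero_or_eventually_ne_zero with h | h
  · left
    filter_upwards [hnear, continuousAt_fst.eventually h] with c hc hc₁
    exact hslice (c.1, q.2) ⟨hc.1, hq⟩ hc₁ c.2 hc.2
  · right
    filter_upwards [hnear, continuousAt_fst.eventually (eventually_nhdsWithin_iff.1 h)]
      with c hc hc₁ hWc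
    by_contra hne
    exact hc₁ hne (hslice c hc hWc q.2 hq)

theorem exists_norm_fderiv_comp_inr_le [CompleteSpace E] {K : Type*} [NormedAddCommGroup K]
    [NormedSpace 𝕜 K] {σ : 𝕜 × K → E} {q : 𝕜 × K} {X Y : E → 𝕜} {C : ℝ≥0} (hσ : AnalyticAt 𝕜 σ q)
    (hX : AnalyticAt 𝕜 X (σ q)) (hY : AnalyticAt 𝕜 Y (σ q)) (hYσ : Y ∘ σ =ᶠ[𝓝 q] Prod.fst)
    (hC : ∀ᶠ z in 𝓝 (σ q), ∀ v, fderiv 𝕜 Y z v = 0 → ‖fderiv 𝕜 X z v‖ ≤ C * ‖X z‖ * ‖v‖) :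
    ∃ B : ℝ, ∀ᶠ c in 𝓝 q,
      ‖fderiv 𝕜 (X ∘ σ) c ∘L ContinuousLinearMap.inr 𝕜 𝕜 K‖ ≤ B * ‖(X ∘ σ) c‖ := by
  set b := ‖fderiv 𝕜 σ q‖ + 1
  have hb : ∀ᶠ c in 𝓝 q, ‖fderiv 𝕜 σ c‖ ≤ b :=
    hσ.fderiv.continuousAt.norm.eventually_le_const (lt_add_one _)
  refine ⟨C * b, ?_⟩
  filter_upwards [hσ.continuousAt.eventually (hC.and (hX.eventually_analyticAt.and
    hY.eventually_analyticAt)), hb, hσ.eventually_analyticAt, hYσ.eventuallyEq_nhds]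
    with c ⟨hCc, hXc, hYc⟩ hbc hσc hYσc
  have hσ' := hσc.differentiableAt.hasFDerivAt
  have hker : ∀ w, fderiv 𝕜 Y (σ c) (fderiv 𝕜 σ c (0, w)) = 0 := fun w =>
    congr($((hYc.differentiableAt.hasFDerivAt.comp c hσ').unique
      (hasFDerivAt_fst.congr_of_eventuallyEq hYσc)) (0, w))
  rw [(hXc.differentiableAt.hasFDerivAt.comp c hσ').fderiv]
  refine ContinuousLinearMap.opNorm_le_bound _ (by positivity) fun w => ?_
  calc ‖fderiv 𝕜 X (σ c) (fderiv 𝕜 σ c (0, w))‖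
      ≤ C * ‖X (σ c)‖ * ‖fderiv 𝕜 σ c (0, w)‖ := hCc _ (hker w)
    _ ≤ C * ‖X (σ c)‖ * (b * ‖w‖) := by
      gcongr
      simpa using (fderiv 𝕜 σ c).le_of_opNorm_le hbc (0, w)
    _ = C * b * ‖(X ∘ σ) c‖ * ‖w‖ := by simp only [Function.comp_apply]; ring

theorem eventually_eq_zero_or_eq_on_zeros [CompleteSpace E] {X Y : E → 𝕜} {p : E} {C : ℝ≥0}
    (hX : AnalyticAt 𝕜 X p) (hY : AnalyticAt 𝕜 Y p) (hY' : fderiv 𝕜 Y p ≠ 0)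
    (hC : ∀ᶠ z in 𝓝 p, ∀ v, fderiv 𝕜 Y z v = 0 → ‖fderiv 𝕜 X z v‖ ≤ C * ‖X z‖ * ‖v‖) :
    (∀ᶠ z in 𝓝 p, X z = 0) ∨ ∀ᶠ z in 𝓝 p, X z = 0 → Y z = Y p := by
  obtain ⟨e, hpe, he, hsymm⟩ := exists_straightening hY (range_eq_top_of_ne_zero hY')
  have hq : e p ∈ e.target := e.map_source hpe
  have hqp : e.symm (e p) = p := e.left_inv hpe
  have hfst : Y ∘ e.symm =ᶠ[𝓝 (e p)] Prod.fst :=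
    (e.eventually_right_inverse hq).mono fun c hc => by rw [Function.comp_apply, ← he, hc]
  rw [← hqp] at hX hY hC
  obtain ⟨B, hB⟩ := exists_norm_fderiv_comp_inr_le (hsymm _ hq) hX hY hfst hC
  have hback : Filter.Tendsto e (𝓝 p) (𝓝 (e p)) := e.continuousAt hpe
  have hleft : ∀ᶠ z in 𝓝 p, e.symm (e z) = z := e.eventually_left_inverse hpe
  rcases eventually_eq_zero_or_fst_eq (hX.comp (hsymm _ hq)) hB with h | h
  · left
    filter_upwards [hback.eventually h, hleft] with z hz hleft
    rwa [Function.comp_apply, hleft] at hz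
  · right
    filter_upwards [hback.eventually h, hleft] with z hz hleft hXz
    rw [← he z, ← he p]
    exact hz (by rwa [Function.comp_apply, hleft])

theorem countable_criticalValues [FiniteDimensional 𝕜 E] {Y : E → 𝕜} {O : Set E}
    (hY : AnalyticOnNhd 𝕜 Y O) : (Y '' {z ∈ O | fderiv 𝕜 Y z = 0}).Countable := by
  induction hd : Module.finrank 𝕜 E using Nat.strong_induction_on generalizing E with
  | _ d IH =>
  have := FiniteDimensional.complete 𝕜 E
  have := FiniteDimensional.proper 𝕜 E
  let b := Module.finBasis 𝕜 E
  set A := {z ∈ O | fderiv 𝕜 Y z = 0}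
  let D (i : Σ n, Fin n → Fin (Module.finrank 𝕜 E)) (z : E) : 𝕜 :=
    iteratedFDeriv 𝕜 i.1 Y z (b ∘ i.2)
  have hcover : A ⊆ {z ∈ A | ∀ᶠ w in 𝓝 z, Y w = Y z} ∪
      ⋃ i, {z ∈ A | D i z = 0 ∧ fderiv 𝕜 (D i) z ≠ 0} := by
    intro z hz
    rcases eventually_eq_or_exists_iteratedFDeriv b (hY z hz.1) hz.2 with h | ⟨n, m, h⟩
    · exact .inl ⟨hz, h⟩
    · exact .inr (Set.mem_iUnion.2 ⟨⟨n, m⟩, hz, h⟩)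
  have hD : ∀ i, AnalyticOnNhd 𝕜 (D i) O := fun i =>
    (ContinuousMultilinearMap.apply 𝕜 _ 𝕜 (b ∘ i.2)).comp_analyticOnNhd (hY.iteratedFDeriv i.1)
  refine Set.Countable.mono (Set.image_mono hcover) ?_
  rw [Set.image_union, Set.image_iUnion]
  refine .union ?_ (Set.countable_iUnion fun i => ?_) <;>
    refine countable_image_of_forall_mem_nhdsWithin fun p hp => ?_
  · refine ⟨_, mem_nhdsWithin_of_mem_nhds hp.2, (Set.countable_singleton (Y p)).mono ?_⟩
    rintro _ ⟨w, hw, rfl⟩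
    exact hw
  · have hrank := Module.Dual.finrank_ker_add_one_of_ne_zero (f := (fderiv 𝕜 (D i) p : E →ₗ[𝕜] 𝕜))
      fun h => hp.2.2 (ContinuousLinearMap.coe_injective h)
    obtain ⟨N, hN, hYN⟩ := exists_countable_image_criticalSet_zeros (hD i p hp.1.1) hp.2.2
      (hY p hp.1.1) fun u W hu => IH _ (by lia) hu rfl
    refine ⟨_, Filter.inter_mem (mem_nhdsWithin_of_mem_nhds hN) self_mem_nhdsWithin,
      hYN.mono (Set.image_mono ?_)⟩
    exact fun z hz => ⟨hz.1, hz.2.2.1, hz.2.1.2⟩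

end AnalyticSard

section PlaneLinearAlgebra

variable {R : Type*} [CommRing R] [TopologicalSpace R]

theorem apply_eq_fst_mul_add_snd_mul (L : R × R →L[R] R) (v : R × R) :
    L v = v.1 * L (1, 0) + v.2 * L (0, 1) := by
  rw [← smul_eq_mul, ← smul_eq_mul, ← map_smul, ← map_smul, ← map_add]
  simp

theorem det_prod_eq (L M : R × R →L[R] R) :
    (L.prod M).det = L (1, 0) * M (0, 1) - L (0, 1) * M (1, 0) := by
  rw [ContinuousLinearMap.det, ← LinearMap.det_toMatrix (Module.Basis.finTwoProd R),
    Matrix.det_fin_two]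
  simp [LinearMap.toMatrix_apply]

theorem isAlt_comp_eq_mul [IsTopologicalRing R] {V : Type*} [TopologicalSpace V] [AddCommGroup V]
    [Module R V] {B : (V →L[R] R) →ₗ[R] (V →L[R] R) →ₗ[R] R} (hB : B.IsAlt)
    (T : V →L[R] R × R) (α β : R × R →L[R] R) :
    B (α ∘L T) (β ∘L T) = B (.fst R R R ∘L T) (.snd R R R ∘L T) *
      (α (1, 0) * β (0, 1) - α (0, 1) * β (1, 0)) := by
  have hexpand (γ : R × R →L[R] R) : γ ∘L T =
      γ (1, 0) • (.fst R R R ∘L T) + γ (0, 1) • (.snd R R R ∘L T) := by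
    ext v
    refine (apply_eq_fst_mul_add_snd_mul γ (T v)).trans ?_
    rw [mul_comm, mul_comm (T v).2]
    rfl
  rw [hexpand α, hexpand β]
  simp only [map_add, map_smul, LinearMap.add_apply, LinearMap.smul_apply, smul_eq_mul,
    hB.self_eq_zero, ← hB.neg (.fst R R R ∘L T)]
  ring

end PlaneLinearAlgebra

section Jacobian

variable {𝕜 : Type*} [NontriviallyNormedField 𝕜]

/-- The Jacobian determinant of `(X, Y)`, that is, the bracket of `X` and `Y` for the constant
Poisson structure `{x, y} = 1`. -/
noncomputable def jacobian (X Y : 𝕜 × 𝕜 → 𝕜) (z : 𝕜 × 𝕜) : 𝕜 :=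
  fderiv 𝕜 X z (1, 0) * fderiv 𝕜 Y z (0, 1) - fderiv 𝕜 X z (0, 1) * fderiv 𝕜 Y z (1, 0)

theorem fderiv_mul_fderiv_sub (X Y : 𝕜 × 𝕜 → 𝕜) (z v w : 𝕜 × 𝕜) :
    fderiv 𝕜 X z v * fderiv 𝕜 Y z w - fderiv 𝕜 X z w * fderiv 𝕜 Y z v =
      (v.1 * w.2 - v.2 * w.1) * jacobian X Y z := by
  simp only [apply_eq_fst_mul_add_snd_mul _ v, apply_eq_fst_mul_add_snd_mul _ w, jacobian]
  ring

end Jacobian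

section Plane

variable {𝕜 : Type*} [RCLike 𝕜] {X Y : 𝕜 × 𝕜 → 𝕜}

theorem exists_norm_fderiv_le_of_jacobian_isBigO {p : 𝕜 × 𝕜} (hY : AnalyticAt 𝕜 Y p)
    (hY' : fderiv 𝕜 Y p ≠ 0) (hJ : jacobian X Y =O[𝓝 p] X) :
    ∃ C : ℝ≥0, ∀ᶠ z in 𝓝 p, ∀ v, fderiv 𝕜 Y z v = 0 → ‖fderiv 𝕜 X z v‖ ≤ C * ‖X z‖ * ‖v‖ := by
  obtain ⟨K, hK, hJK⟩ := hJ.exists_nonneg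
  obtain ⟨w, hw⟩ : ∃ w, fderiv 𝕜 Y p w = 2 :=
    LinearMap.range_eq_top.1 (range_eq_top_of_ne_zero hY') 2
  have hYw : ∀ᶠ z in 𝓝 p, 1 ≤ ‖fderiv 𝕜 Y z w‖ := by
    refine (hY.fderiv.continuousAt.clm_apply continuousAt_const).norm.eventually_const_le ?_
    simp [hw]
  refine ⟨⟨2 * ‖w‖ * K, by positivity⟩, ?_⟩
  filter_upwards [hYw, hJK.bound] with z hYz hJz v hv
  have hdet : ‖v.1 * w.2 - v.2 * w.1‖ ≤ 2 * ‖w‖ * ‖v‖ :=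
    calc ‖v.1 * w.2 - v.2 * w.1‖ ≤ ‖v.1‖ * ‖w.2‖ + ‖v.2‖ * ‖w.1‖ := by
          simpa only [norm_mul] using norm_sub_le (v.1 * w.2) (v.2 * w.1)
      _ ≤ ‖v‖ * ‖w‖ + ‖v‖ * ‖w‖ := by
          gcongr <;> first | exact norm_fst_le _ | exact norm_snd_le _
      _ = 2 * ‖w‖ * ‖v‖ := by ring
  calc ‖fderiv 𝕜 X z v‖ ≤ ‖fderiv 𝕜 X z v‖ * ‖fderiv 𝕜 Y z w‖ :=
        le_mul_of_one_le_right (norm_nonneg _) hYz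
    _ = ‖v.1 * w.2 - v.2 * w.1‖ * ‖jacobian X Y z‖ := by
        rw [← norm_mul, ← norm_mul, ← fderiv_mul_fderiv_sub, hv, mul_zero, sub_zero]
    _ ≤ 2 * ‖w‖ * ‖v‖ * (K * ‖X z‖) := by gcongr
    _ = 2 * ‖w‖ * K * ‖X z‖ * ‖v‖ := by ring

theorem countable_image_zeros_of_jacobian_isBigO {O : Set (𝕜 × 𝕜)}
    (hX : AnalyticOnNhd 𝕜 X O) (hY : AnalyticOnNhd 𝕜 Y O)
    (hX0 : ∀ z ∈ O, ¬ ∀ᶠ w in 𝓝 z, X w = 0)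
    (hJ : ∀ z ∈ O, X z = 0 → jacobian X Y =O[𝓝 z] X) :
    (Y '' {z ∈ O | X z = 0}).Countable := by
  have hregular : (Y '' {z ∈ O | X z = 0 ∧ fderiv 𝕜 Y z ≠ 0}).Countable := by
    refine countable_image_of_forall_mem_nhdsWithin fun p ⟨hpO, hXp, hYp⟩ => ?_
    obtain ⟨C, hC⟩ := exists_norm_fderiv_le_of_jacobian_isBigO (hY p hpO) hYp (hJ p hpO hXp)
    have hlevel := (eventually_eq_zero_or_eq_on_zeros (hX p hpO) (hY p hpO) hYp hC).resolve_left
      (hX0 p hpO)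
    refine ⟨_, Filter.inter_mem self_mem_nhdsWithin (mem_nhdsWithin_of_mem_nhds hlevel),
      (Set.countable_singleton (Y p)).mono ?_⟩
    rintro _ ⟨z, ⟨⟨-, hXz, -⟩, hz⟩, rfl⟩
    exact hz hXz
  refine ((countable_criticalValues hY).union hregular).mono ?_
  rw [← Set.image_union]
  refine Set.image_mono fun z ⟨hzO, hXz⟩ => ?_
  by_cases hYz : fderiv 𝕜 Y z = 0
  · exact .inl ⟨hzO, hYz⟩
  · exact .inr ⟨hzO, hXz, hYz⟩

end Plane

section Cotangent

variable {𝕜 : Type*} [NontriviallyNormedField 𝕜] {F : Type*} [NormedAddCommGroup F]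
  [NormedSpace 𝕜 F] {S : Type*} [TopologicalSpace S] [ChartedSpace F S]

theorem mvfderiv_eq_fderiv_comp_mfderiv {H : Type*} [NormedAddCommGroup H] [NormedSpace 𝕜 H]
    {e : OpenPartialHomeomorph S H} (he : e.MDifferentiable 𝓘(𝕜, F) 𝓘(𝕜, H)) {s : S}
    (hs : s ∈ e.source) {a : S → 𝕜} (ha : MDifferentiableAt 𝓘(𝕜, F) 𝓘(𝕜, 𝕜) a s) :
    mvfderiv 𝓘(𝕜, F) a s = fderiv 𝕜 (a ∘ e.symm) (e s) ∘L mfderiv 𝓘(𝕜, F) 𝓘(𝕜, H) e s := by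
  have hcomp := mvfderiv_comp s
    (ha.comp_of_eq (e s) (he.mdifferentiableAt_symm (e.map_source hs)) (e.left_inv hs))
    (he.mdifferentiableAt hs)
  have hae : a =ᶠ[𝓝 s] (a ∘ e.symm) ∘ e :=
    (e.eventually_left_inverse hs).mono fun y hy => congrArg a hy.symm
  rw [mvfderiv, hae.mfderiv_eq]
  refine hcomp.trans ?_
  rw [mvfderiv, mfderiv_eq_fderiv]
  rfl

theorem mvfderiv_clm_comp_eq {H : Type*} [NormedAddCommGroup H] [NormedSpace 𝕜 H] {e : S → H}
    {s : S} (he : MDifferentiableAt 𝓘(𝕜, F) 𝓘(𝕜, H) e s) (P : H →L[𝕜] 𝕜) :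
    mvfderiv 𝓘(𝕜, F) (fun s => P (e s)) s = P ∘L mfderiv 𝓘(𝕜, F) 𝓘(𝕜, H) e s := by
  refine (mvfderiv_comp s (g := P) P.mdifferentiableAt he).trans ?_
  rw [mvfderiv, mfderiv_eq_fderiv, P.fderiv]
  rfl

end Cotangent

section Surface

variable {𝕜 : Type*} [RCLike 𝕜] {F : Type*} [NormedAddCommGroup F] [NormedSpace 𝕜 F]
  {S : Type*} [TopologicalSpace S] [ChartedSpace F S]

namespace BivectorField

variable {ϖ : BivectorField 𝕜 F S} {e : OpenPartialHomeomorph S (𝕜 × 𝕜)} {s : S}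

theorem bracket_coord_eq_form (he : MDifferentiableAt 𝓘(𝕜, F) 𝓘(𝕜, 𝕜 × 𝕜) e s) :
    ϖ.bracket (fun s => (e s).1) (fun s => (e s).2) s =
      ϖ.form s (.fst 𝕜 𝕜 𝕜 ∘L mfderiv 𝓘(𝕜, F) 𝓘(𝕜, 𝕜 × 𝕜) e s)
        (.snd 𝕜 𝕜 𝕜 ∘L mfderiv 𝓘(𝕜, F) 𝓘(𝕜, 𝕜 × 𝕜) e s) := by
  rw [← mvfderiv_clm_comp_eq he, ← mvfderiv_clm_comp_eq he]
  rfl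

theorem bracket_eq_mul_jacobian (he : e.MDifferentiable 𝓘(𝕜, F) 𝓘(𝕜, 𝕜 × 𝕜))
    (hs : s ∈ e.source) {a b : S → 𝕜} (ha : MDifferentiableAt 𝓘(𝕜, F) 𝓘(𝕜, 𝕜) a s)
    (hb : MDifferentiableAt 𝓘(𝕜, F) 𝓘(𝕜, 𝕜) b s) :
    ϖ.bracket a b s = ϖ.bracket (fun s => (e s).1) (fun s => (e s).2) s *
      jacobian (a ∘ e.symm) (b ∘ e.symm) (e s) := by
  rw [bracket_coord_eq_form (he.mdifferentiableAt hs), bracket,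
    mvfderiv_eq_fderiv_comp_mfderiv he hs ha, mvfderiv_eq_fderiv_comp_mfderiv he hs hb]
  exact isAlt_comp_eq_mul (ϖ.isAlt s) _ _ _

theorem bracket_coord_ne_zero (he : e.MDifferentiable 𝓘(𝕜, F) 𝓘(𝕜, 𝕜 × 𝕜)) (hs : s ∈ e.source)
    (hϖ : (ϖ.form s).Nondegenerate) : ϖ.bracket (fun s => (e s).1) (fun s => (e s).2) s ≠ 0 := by
  rw [bracket_coord_eq_form (he.mdifferentiableAt hs)]
  intro h0
  let T : TangentSpace 𝓘(𝕜, F) s ≃L[𝕜] 𝕜 × 𝕜 := he.mfderiv hs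
  have hzero (α : Cotangent 𝕜 F s) : α = 0 := by
    refine hϖ.1 α fun β => ?_
    have h (γ : Cotangent 𝕜 F s) : (γ ∘L (T.symm : 𝕜 × 𝕜 →L[𝕜] _)) ∘L T = γ := by
      ext v; simp
    rw [← h α, ← h β]
    refine (isAlt_comp_eq_mul (ϖ.isAlt s) _ _ _).trans (mul_eq_zero_of_left h0 _)
  simpa using congr($(hzero (.fst 𝕜 𝕜 𝕜 ∘L (T : _ →L[𝕜] 𝕜 × 𝕜))) (T.symm (1, 0)))

end BivectorField

theorem exists_planarChart (hF : Module.finrank 𝕜 F = 2)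
    {n : WithTop ℕ∞} [IsManifold 𝓘(𝕜, F) n S] (s : S) :
    ∃ e : OpenPartialHomeomorph S (𝕜 × 𝕜), s ∈ e.source ∧
      ContMDiffOn 𝓘(𝕜, F) 𝓘(𝕜, 𝕜 × 𝕜) n e e.source ∧
      ContMDiffOn 𝓘(𝕜, 𝕜 × 𝕜) 𝓘(𝕜, F) n e.symm e.target := by
  have : FiniteDimensional 𝕜 F := .of_finrank_pos (by lia)
  let L : F ≃L[𝕜] 𝕜 × 𝕜 := ContinuousLinearEquiv.ofFinrankEq (by simp [hF])
  exact ⟨(chartAt F s).transHomeomorph L.toHomeomorph, mem_chart_source F s,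
    L.contDiff.contMDiff.comp_contMDiffOn contMDiffOn_chart,
    contMDiffOn_chart_symm.comp L.symm.contDiff.contMDiff.contMDiffOn fun _ hz => hz⟩

theorem BivectorField.IsSymplectic.jacobian_isBigO_bracket {n : WithTop ℕ∞} (hn : n ≠ 0)
    {ϖ : BivectorField 𝕜 F S} (hϖ : ϖ.IsSymplectic n) {e : OpenPartialHomeomorph S (𝕜 × 𝕜)}
    (he : ContMDiffOn 𝓘(𝕜, F) 𝓘(𝕜, 𝕜 × 𝕜) n e e.source)
    (he' : ContMDiffOn 𝓘(𝕜, 𝕜 × 𝕜) 𝓘(𝕜, F) n e.symm e.target)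
    {a b : S → 𝕜} (ha : MDifferentiable 𝓘(𝕜, F) 𝓘(𝕜, 𝕜) a)
    (hb : MDifferentiable 𝓘(𝕜, F) 𝓘(𝕜, 𝕜) b) {z : 𝕜 × 𝕜} (hz : z ∈ e.target) :
    jacobian (a ∘ e.symm) (b ∘ e.symm) =O[𝓝 z] (ϖ.bracket a b ∘ e.symm) := by
  have hed : e.MDifferentiable 𝓘(𝕜, F) 𝓘(𝕜, 𝕜 × 𝕜) :=
    ⟨he.mdifferentiableOn hn, he'.mdifferentiableOn hn⟩
  set w : S → 𝕜 := ϖ.bracket (fun s => (e s).1) (fun s => (e s).2)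
  have hw : ContinuousAt (w ∘ e.symm) z := by
    have := (hϖ.isPoisson.contMDiffOn_bracket e.source e.open_source _ _
      (contDiff_fst.contMDiff.comp_contMDiffOn he) (contDiff_snd.contMDiff.comp_contMDiffOn he))
    exact (this.continuousOn.continuousAt (e.open_source.mem_nhds (e.map_target hz))).comp
      (e.continuousAt_symm hz)
  have hw0 : ∀ z ∈ e.target, w (e.symm z) ≠ 0 := fun z hz =>
    BivectorField.bracket_coord_ne_zero hed (e.map_target hz) (hϖ.nondegenerate _)
  have hjac : ∀ᶠ z in 𝓝 z, (w (e.symm z))⁻¹ * ϖ.bracket a b (e.symm z) =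
      jacobian (a ∘ e.symm) (b ∘ e.symm) z := by
    filter_upwards [e.open_target.mem_nhds hz] with z hz
    rw [BivectorField.bracket_eq_mul_jacobian hed (e.map_target hz) (ha _) (hb _),
      inv_mul_cancel_left₀ (hw0 z hz), e.right_inv hz]
  have hinv := ((hw.inv₀ (hw0 z hz)).isBigO_one 𝕜).mul
    (Asymptotics.isBigO_refl (ϖ.bracket a b ∘ e.symm) (𝓝 z))
  exact hinv.congr' hjac (.of_forall fun _ => one_mul _)

theorem BivectorField.IsPoisson.bracket_isBigO_of_ne_zero {n : WithTop ℕ∞}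
    {π : BivectorField 𝕜 F S} (hπ : π.IsPoisson n) {a b : S → 𝕜}
    (ha : ContMDiff 𝓘(𝕜, F) 𝓘(𝕜, 𝕜) n a) (hb : ContMDiff 𝓘(𝕜, F) 𝓘(𝕜, 𝕜) n b) {s : S}
    (hs : a s ≠ 0) : π.bracket a b =O[𝓝 s] a := by
  have hbracket : Continuous (π.bracket a b) := by
    simpa only [continuousOn_univ] using
      (hπ.contMDiffOn_bracket _ isOpen_univ a b ha.contMDiffOn hb.contMDiffOn).continuousOn
  exact (Asymptotics.isBigO_const_of_tendsto hbracket.continuousAt hs).trans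
    ((Asymptotics.isEquivalent_const_iff_tendsto hs).2 ha.continuous.continuousAt).isBigO_symm

variable {E : Type*} [NormedAddCommGroup E] [NormedSpace 𝕜 E] {M : Type*} [TopologicalSpace M]
  [ChartedSpace E M] {n : WithTop ℕ∞} {π : BivectorField 𝕜 E M} {ϖ : BivectorField 𝕜 F S}
  {φ : S → M}

theorem IsSymplecticResolution.bracket_comp (h : IsSymplecticResolution n π ϖ φ) (hn : n ≠ 0)
    {x y : M → 𝕜} (hx : MDifferentiable 𝓘(𝕜, E) 𝓘(𝕜, 𝕜) x)
    (hy : MDifferentiable 𝓘(𝕜, E) 𝓘(𝕜, 𝕜) y) :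
    ϖ.bracket (x ∘ φ) (y ∘ φ) = π.bracket x y ∘ φ := by
  ext s
  have hφ := h.contMDiff.mdifferentiableAt hn (x := s)
  rw [BivectorField.bracket, mvfderiv_comp s (hx _) hφ, mvfderiv_comp s (hy _) hφ, h.form_comp]
  rfl

theorem IsSymplecticResolution.bracket_comp_isBigO (h : IsSymplecticResolution n π ϖ φ)
    (hn : n ≠ 0) {x y : M → 𝕜} (hx : ContMDiff 𝓘(𝕜, E) 𝓘(𝕜, 𝕜) n x)
    (hy : ContMDiff 𝓘(𝕜, E) 𝓘(𝕜, 𝕜) n y) (hxy : ∀ z, x z = 0 → π.bracket x y =O[𝓝 z] x) (s : S) :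
    ϖ.bracket (x ∘ φ) (y ∘ φ) =O[𝓝 s] (x ∘ φ) := by
  by_cases hs : x (φ s) = 0
  · rw [h.bracket_comp hn (hx.mdifferentiable hn) (hy.mdifferentiable hn)]
    exact (hxy _ hs).comp_tendsto h.contMDiff.continuous.continuousAt
  · exact h.isSymplectic.isPoisson.bracket_isBigO_of_ne_zero (hx.comp h.contMDiff)
      (hy.comp h.contMDiff) hs

end Surface

section LogArea

open MeasureTheory

theorem exists_volume_image_log_lt_top {X Y : ℝ × ℝ → ℝ} {p : ℝ × ℝ}
    (hX : ∀ᶠ z in 𝓝 p, DifferentiableAt ℝ X z) (hY : ∀ᶠ z in 𝓝 p, DifferentiableAt ℝ Y z)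
    (hJ : jacobian X Y =O[𝓝 p] X) :
    ∃ N ∈ 𝓝 p, volume ((fun z => (Real.log (X z), Y z)) '' (N ∩ {z | X z ≠ 0})) < ⊤ := by
  obtain ⟨C, hC⟩ := hJ.bound
  obtain ⟨r, hr, hball⟩ := Metric.eventually_nhds_iff_ball.1 (hX.and (hY.and hC))
  set A := Metric.ball p r ∩ {z | X z ≠ 0}
  have hA : MeasurableSet A := (ContinuousOn.isOpen_inter_preimage
    (fun z hz => (hball z hz).1.continuousAt.continuousWithinAt) Metric.isOpen_ball
    isOpen_ne).measurableSet
  have hderiv : ∀ z ∈ A, HasFDerivWithinAt (fun z => (Real.log (X z), Y z))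
      (((X z)⁻¹ • fderiv ℝ X z).prod (fderiv ℝ Y z)) A z := fun z hz =>
    (((hball z hz.1).1.hasFDerivAt.log hz.2).prodMk
      (hball z hz.1).2.1.hasFDerivAt).hasFDerivWithinAt
  have hdet : ∀ z ∈ A, |(((X z)⁻¹ • fderiv ℝ X z).prod (fderiv ℝ Y z)).det| ≤ C := by
    intro z hz
    have hCz := (hball z hz.1).2.2
    have hjac : (((X z)⁻¹ • fderiv ℝ X z).prod (fderiv ℝ Y z)).det = jacobian X Y z / X z := by
      simp only [det_prod_eq, jacobian, smul_apply, smul_eq_mul]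
      ring
    rw [hjac, abs_div]
    exact (div_le_iff₀ (abs_pos.2 hz.2)).2 hCz
  refine ⟨Metric.ball p r, Metric.ball_mem_nhds p hr, ?_⟩
  calc volume ((fun z => (Real.log (X z), Y z)) '' A)
      ≤ ∫⁻ z in A, ENNReal.ofReal |(((X z)⁻¹ • fderiv ℝ X z).prod (fderiv ℝ Y z)).det| :=
        addHaar_image_le_lintegral_abs_det_fderiv _ hA hderiv
    _ ≤ ∫⁻ _ in A, ENNReal.ofReal C :=
        setLIntegral_mono measurable_const fun z hz => ENNReal.ofReal_le_ofReal (hdet z hz)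
    _ = ENNReal.ofReal C * volume A := setLIntegral_const _ _
    _ < ⊤ := ENNReal.mul_lt_top ENNReal.ofReal_lt_top
        ((measure_mono Set.inter_subset_left).trans_lt measure_ball_lt_top)

variable {F : Type*} [NormedAddCommGroup F] [NormedSpace ℝ F]
  {S : Type*} [TopologicalSpace S] [ChartedSpace F S]

theorem BivectorField.IsSymplectic.exists_volume_image_log_lt_top {n : WithTop ℕ∞} (hn : n ≠ 0)
    [IsManifold 𝓘(ℝ, F) n S] (hF : Module.finrank ℝ F = 2) {ϖ : BivectorField ℝ F S}
    (hϖ : ϖ.IsSymplectic n) {a b : S → ℝ} (ha : MDifferentiable 𝓘(ℝ, F) 𝓘(ℝ, ℝ) a)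
    (hb : MDifferentiable 𝓘(ℝ, F) 𝓘(ℝ, ℝ) b) {s : S} (hab : ϖ.bracket a b =O[𝓝 s] a) :
    ∃ N ∈ 𝓝 s, volume ((fun s => (Real.log (a s), b s)) '' (N ∩ {s | a s ≠ 0})) < ⊤ := by
  obtain ⟨e, hse, he, he'⟩ := exists_planarChart (n := n) hF s
  have hdiff : ∀ c : S → ℝ, MDifferentiable 𝓘(ℝ, F) 𝓘(ℝ, ℝ) c →
      ∀ᶠ z in 𝓝 (e s), DifferentiableAt ℝ (c ∘ e.symm) z := fun c hc => by
    filter_upwards [e.open_target.mem_nhds (e.map_source hse)] with z hz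
    exact ((hc _).comp z ((he'.mdifferentiableOn hn z hz).mdifferentiableAt
      (e.open_target.mem_nhds hz))).differentiableAt
  obtain ⟨N, hN, hlt⟩ := PoissonGeometry.exists_volume_image_log_lt_top (hdiff a ha) (hdiff b hb)
    ((hϖ.jacobian_isBigO_bracket hn he he' ha hb (e.map_source hse)).trans
      (hab.comp_tendsto (e.tendsto_symm hse)))
  refine ⟨e.source ∩ e ⁻¹' N, Filter.inter_mem (e.open_source.mem_nhds hse)
    (e.continuousAt hse hN), (measure_mono ?_).trans_lt hlt⟩
  rintro _ ⟨y, ⟨⟨hye, hyN⟩, hy0⟩, rfl⟩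
  have hy : e.symm (e y) = y := e.left_inv hye
  exact ⟨e y, ⟨hyN, by simpa [hy] using hy0⟩, by simp [hy]⟩

theorem measure_image_inter_lt_top_of_isCompact {α β : Type*} [TopologicalSpace α]
    [MeasurableSpace β] {μ : Measure β} {f : α → β} {K A : Set α} (hK : IsCompact K)
    (h : ∀ s ∈ K, ∃ N ∈ 𝓝 s, μ (f '' (N ∩ A)) < ⊤) : μ (f '' (K ∩ A)) < ⊤ := by
  choose! N hN hfN using h
  obtain ⟨t, htK, hKt⟩ := hK.elim_nhds_subcover N hN
  refine (measure_mono ?_).trans_lt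
    (measure_biUnion_lt_top t.finite_toSet fun s hs => hfN s (htK s hs))
  rw [← Set.image_iUnion₂, ← Set.iUnion₂_inter]
  exact Set.image_mono (Set.inter_subset_inter_left A hKt)

theorem IsSymplecticResolution.not_isProperMap {n : WithTop ℕ∞} [IsManifold 𝓘(ℝ, F) n S]
    {π : BivectorField ℝ (ℝ × ℝ) (ℝ × ℝ)} {ϖ : BivectorField ℝ F S} {φ : S → ℝ × ℝ}
    (h : IsSymplecticResolution n π ϖ φ) (hn : n ≠ 0)
    (hπ : ∀ z : ℝ × ℝ, z.1 = 0 → π.bracket Prod.fst Prod.snd =O[𝓝 z] Prod.fst) :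
    ¬IsProperMap φ := by
  intro hφ
  have hfst : ContMDiff 𝓘(ℝ, ℝ × ℝ) 𝓘(ℝ, ℝ) n Prod.fst := contDiff_fst.contMDiff
  have hsnd : ContMDiff 𝓘(ℝ, ℝ × ℝ) 𝓘(ℝ, ℝ) n Prod.snd := contDiff_snd.contMDiff
  have hK : IsCompact (φ ⁻¹' (Set.Icc 0 1 ×ˢ Set.Icc 0 1)) :=
    hφ.isCompact_preimage (isCompact_Icc.prod isCompact_Icc)
  have hfinite := measure_image_inter_lt_top_of_isCompact hK fun s _ =>
    h.isSymplectic.exists_volume_image_log_lt_top hn (h.finrank_eq.trans (by simp))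
      ((hfst.comp h.contMDiff).mdifferentiable hn) ((hsnd.comp h.contMDiff).mdifferentiable hn)
      (h.bracket_comp_isBigO hn hfst hsnd hπ s)
  have hcover : Set.Iic (0 : ℝ) ×ˢ Set.Icc (0 : ℝ) 1 ⊆
      (fun s => (Real.log (φ s).1, (φ s).2)) ''
        (φ ⁻¹' (Set.Icc 0 1 ×ˢ Set.Icc 0 1) ∩ {s | (φ s).1 ≠ 0}) := by
    rintro ⟨t, y⟩ ⟨ht, hy⟩
    obtain ⟨s, hs⟩ := h.surjective (Real.exp t, y)
    refine ⟨s, ⟨?_, ?_⟩, ?_⟩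
    · rw [Set.mem_preimage, hs]
      exact ⟨⟨(Real.exp_pos t).le, Real.exp_le_one_iff.2 ht⟩, hy⟩
    · simp [hs]
    · simp [hs]
  have hstrip : volume (Set.Iic (0 : ℝ) ×ˢ Set.Icc (0 : ℝ) 1) = ⊤ := by
    simp [Measure.volume_eq_prod]
  exact (hstrip.ge.trans (measure_mono hcover)).not_gt hfinite

end LogArea

section Analytic

variable {𝕜 : Type*} [RCLike 𝕜] {F : Type*} [NormedAddCommGroup F] [NormedSpace 𝕜 F]
  {S : Type*} [TopologicalSpace S] [ChartedSpace F S]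

theorem analyticOnNhd_comp_symm {H : Type*} [NormedAddCommGroup H] [NormedSpace 𝕜 H]
    {a : S → 𝕜} (ha : ContMDiff 𝓘(𝕜, F) 𝓘(𝕜, 𝕜) ω a) {e : OpenPartialHomeomorph S H}
    (he : ContMDiffOn 𝓘(𝕜, H) 𝓘(𝕜, F) ω e.symm e.target) :
    AnalyticOnNhd 𝕜 (a ∘ e.symm) e.target := fun _ hz =>
  ((contMDiffOn_iff_contDiffOn.1 (ha.comp_contMDiffOn he)).contDiffAt
    (e.open_target.mem_nhds hz)).analyticAt

theorem eventually_comp_symm_eq_zero_iff {H : Type*} [TopologicalSpace H] {a : S → 𝕜}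
    (e : OpenPartialHomeomorph S H) {z : H} (hz : z ∈ e.target) :
    (∀ᶠ w in 𝓝 z, (a ∘ e.symm) w = 0) ↔ ∀ᶠ y in 𝓝 (e.symm z), a y = 0 := by
  rw [← e.symm.map_nhds_eq hz]
  rfl

theorem isClopen_setOf_eventually_eq_zero [IsManifold 𝓘(𝕜, F) ω S] {a : S → 𝕜}
    (ha : ContMDiff 𝓘(𝕜, F) 𝓘(𝕜, 𝕜) ω a) : IsClopen {s | ∀ᶠ y in 𝓝 s, a y = 0} := by
  refine ⟨isClosed_of_closure_subset fun s hs => ?_, isOpen_setOfPred_eventually_nhds⟩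
  let : NormedSpace ℝ F := .restrictScalars ℝ 𝕜 F
  set e := chartAt F s
  have hse : s ∈ e.source := mem_chart_source F s
  have hae : AnalyticOnNhd 𝕜 (a ∘ e.symm) e.target :=
    analyticOnNhd_comp_symm ha contMDiffOn_chart_symm
  obtain ⟨r, hr, hball⟩ := Metric.isOpen_iff.1 e.open_target (e s) (e.map_source hse)
  obtain ⟨y, ⟨hye, hyr⟩, hy⟩ := mem_closure_iff_nhds.1 hs _
    ((e.isOpen_inter_preimage Metric.isOpen_ball).mem_nhds ⟨hse, Metric.mem_ball_self hr⟩)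
  have hzero := (hae.mono hball).eqOn_zero_of_preconnected_of_eventuallyEq_zero
    (convex_ball (e s) r).isPreconnected hyr
    ((eventually_comp_symm_eq_zero_iff e (hball hyr)).2 (by rwa [e.left_inv hye]))
  rw [Set.mem_ofPred_eq, ← e.left_inv hse, ← eventually_comp_symm_eq_zero_iff e (e.map_source hse)]
  exact Filter.eventually_of_mem (Metric.ball_mem_nhds _ hr) hzero

theorem not_eventually_eq_zero_of_ne_zero [IsManifold 𝓘(𝕜, F) ω S] [PreconnectedSpace S]
    {a : S → 𝕜} (ha : ContMDiff 𝓘(𝕜, F) 𝓘(𝕜, 𝕜) ω a) {s : S} (hs : a s ≠ 0) (t : S) :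
    ¬∀ᶠ y in 𝓝 t, a y = 0 := by
  rcases isClopen_iff.1 (isClopen_setOf_eventually_eq_zero ha) with hempty | huniv
  · exact Set.eq_empty_iff_forall_notMem.1 hempty t
  · exact absurd (Set.eq_univ_iff_forall.1 huniv s).self_of_nhds hs

theorem BivectorField.IsSymplectic.countable_image_zeros [SecondCountableTopology S]
    [IsManifold 𝓘(𝕜, F) ω S] (hF : Module.finrank 𝕜 F = 2) {ϖ : BivectorField 𝕜 F S}
    (hϖ : ϖ.IsSymplectic ω) {a b : S → 𝕜} (ha : ContMDiff 𝓘(𝕜, F) 𝓘(𝕜, 𝕜) ω a)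
    (hb : ContMDiff 𝓘(𝕜, F) 𝓘(𝕜, 𝕜) ω b) (ha0 : ∀ s, ¬∀ᶠ y in 𝓝 s, a y = 0)
    (hab : ∀ s, a s = 0 → ϖ.bracket a b =O[𝓝 s] a) : (b '' {s | a s = 0}).Countable := by
  refine countable_image_of_forall_mem_nhdsWithin fun s _ => ?_
  obtain ⟨e, hse, he, he'⟩ := exists_planarChart (n := ω) hF s
  have hcount := countable_image_zeros_of_jacobian_isBigO (analyticOnNhd_comp_symm ha he')
    (analyticOnNhd_comp_symm hb he')
    (fun z hz => mt (eventually_comp_symm_eq_zero_iff e hz).1 (ha0 _))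
    fun z hz haz => (hϖ.jacobian_isBigO_bracket WithTop.top_ne_zero he he'
      (ha.mdifferentiable WithTop.top_ne_zero) (hb.mdifferentiable WithTop.top_ne_zero) hz).trans
      ((hab _ haz).comp_tendsto (e.continuousAt_symm hz))
  refine ⟨_, Filter.inter_mem self_mem_nhdsWithin
    (mem_nhdsWithin_of_mem_nhds (e.open_source.mem_nhds hse)), hcount.mono ?_⟩
  rintro _ ⟨y, ⟨hy0, hye⟩, rfl⟩
  have hy : e.symm (e y) = y := e.left_inv hye
  exact ⟨e y, ⟨e.map_source hye, by simpa [hy] using hy0⟩, by simp [hy]⟩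

theorem IsSymplecticResolution.not_connectedSpace [SecondCountableTopology S]
    [IsManifold 𝓘(𝕜, F) ω S] {E : Type*} [NormedAddCommGroup E] [NormedSpace 𝕜 E]
    (hE : Module.finrank 𝕜 E = 2) {M : Type*} [TopologicalSpace M] [ChartedSpace E M]
    {π : BivectorField 𝕜 E M} {ϖ : BivectorField 𝕜 F S} {φ : S → M}
    (h : IsSymplecticResolution ω π ϖ φ) {x y : M → 𝕜} (hx : ContMDiff 𝓘(𝕜, E) 𝓘(𝕜, 𝕜) ω x)
    (hy : ContMDiff 𝓘(𝕜, E) 𝓘(𝕜, 𝕜) ω y) (hxy : ∀ z, x z = 0 → π.bracket x y =O[𝓝 z] x)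
    (hx0 : ∃ z, x z ≠ 0) (hcount : ¬(y '' {z | x z = 0}).Countable) : ¬ConnectedSpace S := by
  intro _
  obtain ⟨z, hz⟩ := hx0
  obtain ⟨s, rfl⟩ := h.surjective z
  refine hcount ((h.isSymplectic.countable_image_zeros (h.finrank_eq.trans hE)
    (hx.comp h.contMDiff) (hy.comp h.contMDiff)
    (not_eventually_eq_zero_of_ne_zero (hx.comp h.contMDiff) hz)
    fun s _ => h.bracket_comp_isBigO WithTop.top_ne_zero hx hy hxy s).mono ?_)
  rintro _ ⟨z, hz, rfl⟩
  obtain ⟨s, rfl⟩ := h.surjective z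
  exact ⟨s, hz, rfl⟩

end Analytic

theorem mainTheorem2_general (𝕜 : Type u) [RCLike 𝕜] :
    (∀ f : ℝ × ℝ → ℝ, (∀ z : ℝ × ℝ, z.1 = 0 → f =O[𝓝 z] Prod.fst) →
      ∀ (F : Type v) [NormedAddCommGroup F] [NormedSpace ℝ F]
        (S : Type w) [TopologicalSpace S] [ChartedSpace F S] [IsManifold 𝓘(ℝ, F) ∞ S]
        (ϖ : BivectorField ℝ F S) (φ : S → ℝ × ℝ),
        IsSymplecticResolution ∞ (planarBivector f) ϖ φ → ¬IsProperMap φ) ∧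
    (∀ f : 𝕜 × 𝕜 → 𝕜, (∀ z : 𝕜 × 𝕜, z.1 = 0 → f =O[𝓝 z] Prod.fst) →
      ∀ (F : Type v) [NormedAddCommGroup F] [NormedSpace 𝕜 F]
        (S : Type w) [TopologicalSpace S] [SecondCountableTopology S] [ChartedSpace F S]
        [IsManifold 𝓘(𝕜, F) ω S] (ϖ : BivectorField 𝕜 F S) (φ : S → 𝕜 × 𝕜),
        IsSymplecticResolution ω (planarBivector f) ϖ φ → ¬ConnectedSpace S) ∧
    (∀ (U : TopologicalSpace.Opens (𝕜 × 𝕜)) (y : 𝕜), (0, y) ∈ U →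
      ∀ f : U → 𝕜, (∀ z : U, (z : 𝕜 × 𝕜).1 = 0 → f =O[𝓝 z] fun z => (z : 𝕜 × 𝕜).1) →
      ∀ (F : Type v) [NormedAddCommGroup F] [NormedSpace 𝕜 F]
        (S : Type w) [TopologicalSpace S] [SecondCountableTopology S] [ChartedSpace F S]
        [IsManifold 𝓘(𝕜, F) ω S] (ϖ : BivectorField 𝕜 F S) (φ : S → U),
        IsSymplecticResolution ω (planarBivector f) ϖ φ → ¬ConnectedSpace S) := by
  refine ⟨fun f hf F _ _ S _ _ _ ϖ φ h => ?_, fun f hf F _ _ S _ _ _ _ ϖ φ h => ?_,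
    fun U y hy f hf F _ _ S _ _ _ _ ϖ φ h => ?_⟩
  · refine h.not_isProperMap (by simp) ?_
    rwa [funext (planarBivector_bracket_coord f)]
  · have hcount : ¬(Prod.snd '' {z : 𝕜 × 𝕜 | z.1 = 0}).Countable := by
      refine not_countable_of_mem_nhds (a := 0) (Filter.mem_of_superset Filter.univ_mem ?_)
      exact fun y _ => ⟨(0, y), rfl, rfl⟩
    refine h.not_connectedSpace (by simp) contDiff_fst.contMDiff contDiff_snd.contMDiff ?_
      ⟨(1, 0), one_ne_zero⟩ hcount
    rwa [funext (planarBivector_bracket_coord f)]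
  · refine h.not_connectedSpace (by simp) (contDiff_fst.contMDiff.comp contMDiff_subtype_val)
      (contDiff_snd.contMDiff.comp contMDiff_subtype_val) ?_ (exists_fst_ne_zero U hy)
      (not_countable_image_snd_axis U hy)
    exact (funext (planarBivector_bracket_coord_opens U f)).symm ▸ hf

end PoissonGeometry

theorem mainTheorem2 :
    -- smooth case: no proper resolution
    (∀ g : ℝ × ℝ → ℝ, ContDiff ℝ ∞ g → (∀ z : ℝ × ℝ, z.1 ≠ 0 → g z ≠ 0) →
      ∀ (F : Type v) [NormedAddCommGroup F] [NormedSpace ℝ F]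
        (S : Type w) [TopologicalSpace S] [T2Space S] [ChartedSpace F S] [IsManifold 𝓘(ℝ, F) ∞ S]
        (ϖ : PoissonGeometry.BivectorField ℝ F S) (φ : S → ℝ × ℝ),
        PoissonGeometry.IsSymplecticResolution ∞
          (PoissonGeometry.planarBivector fun z : ℝ × ℝ => z.1 * g z) ϖ φ →
        ¬ IsProperMap φ) ∧
    -- real analytic case: no connected resolution
    (∀ g : ℝ × ℝ → ℝ, ContDiff ℝ ∞ g → (∀ z : ℝ × ℝ, z.1 ≠ 0 → g z ≠ 0) →
      AnalyticOnNhd ℝ (fun z : ℝ × ℝ => z.1 * g z) Set.univ →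
      ∀ (F : Type v) [NormedAddCommGroup F] [NormedSpace ℝ F]
        (S : Type w) [TopologicalSpace S] [T2Space S] [SecondCountableTopology S]
        [ChartedSpace F S] [IsManifold 𝓘(ℝ, F) ω S]
        (ϖ : PoissonGeometry.BivectorField ℝ F S) (φ : S → ℝ × ℝ),
        PoissonGeometry.IsSymplecticResolution ω
          (PoissonGeometry.planarBivector fun z : ℝ × ℝ => z.1 * g z) ϖ φ →
        ¬ ConnectedSpace S) ∧
    -- holomorphic case: no connected resolution
    (∀ U : TopologicalSpace.Opens (ℂ × ℂ), (0, 0) ∈ U →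
      ∀ g : ℂ × ℂ → ℂ, (∀ z ∈ U, z.1 ≠ 0 → g z ≠ 0) →
      DifferentiableOn ℂ (fun z : ℂ × ℂ => z.1 * g z) U →
      ∀ (F : Type v) [NormedAddCommGroup F] [NormedSpace ℂ F]
        (S : Type w) [TopologicalSpace S] [T2Space S] [SecondCountableTopology S]
        [ChartedSpace F S] [IsManifold 𝓘(ℂ, F) ω S]
        (ϖ : PoissonGeometry.BivectorField ℂ F S) (φ : S → U),
        PoissonGeometry.IsSymplecticResolution ω
          (PoissonGeometry.planarBivector fun z : U => (z : ℂ × ℂ).1 * g z) ϖ φ →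
        ¬ ConnectedSpace S) := by
  refine ⟨fun g hg _ F _ _ S _ _ _ _ ϖ φ h => ?_, fun g hg _ _ F _ _ S _ _ _ _ _ ϖ φ h => ?_,
    fun U h0 g _ hf F _ _ S _ _ _ _ _ ϖ φ h => ?_⟩
  · exact (PoissonGeometry.mainTheorem2_general ℝ).1 _
      (fun z _ => PoissonGeometry.isBigO_fst_mul hg.continuous.continuousAt) F S ϖ φ h
  · exact (PoissonGeometry.mainTheorem2_general ℝ).2.1 _
      (fun z _ => PoissonGeometry.isBigO_fst_mul hg.continuous.continuousAt) F S ϖ φ h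
  · refine (PoissonGeometry.mainTheorem2_general ℂ).2.2 U 0 h0 _ (fun z hz => ?_) F S ϖ φ h
    refine (PoissonGeometry.isBigO_fst_of_eventually_differentiableAt
      (f := fun z : ℂ × ℂ => z.1 * g z) ?_ ?_ hz).comp_tendsto
      continuousAt_subtype_val
    · exact hf.eventually_differentiableAt (U.isOpen.mem_nhds z.2)
    · exact .of_forall fun z hz => mul_eq_zero_of_left hz _
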